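/- \textbf{Game.} Fix $d$. In round $t=1,2,\dots$ the player predicts $x_t\in\mathbb R^d$; the environment picks a convex loss $l_t:\mathbb R^d\to\mathbb R$ and reveals a subgradient $g_t\in\partial l_t(x_t)$; a discount factor $\lambda_{t-1}\in(0,\infty)$ is revealed. Losses and discount factors are otherwise arbitrary (and may depend on the past). Put, with empty products equal to $1$ and $\|\cdot\|$ the Euclidean norm, $$\mathrm{Regret}_T(u)=\sum_{t=1}^T\Big(\prod_{i=t}^{T-1}\lambda_i\Big)\big[l_t(x_t)-l_t(u)\big],\quad V_t=\sum_{i=1}^t\Big(\prod_{j=i}^{t-1}\lambda_j^2\Big)\|g_i\|^2,\quad G_t=\max_{1\le i\le t}\Big(\prod_{j=i}^{t-1}\lambda_j\Big)\|g_i\| .$$ \textbf{Algorithm} (hyperparameter $\varepsilon>0$, any starting direction $w_1$ with $\|w_1\|\le1$). Set $h_1=v_1=s_1=0$ and $\mathrm{erfi}(x)=\int_0^x e^{r^2}dr$. In round $t$: 1. If $h_t=0$ set $\tilde y_t=0$; otherwise, with $z_t=v_t+2h_ts_t+16h_t^2$, set $$\tilde y_t=\varepsilon\,\mathrm{erfi}\Big(\frac{s_t}{2\sqrt{z_t}}\Big)-\frac{\varepsilon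 h_t}{\sqrt{z_t}}\exp\Big(\frac{s_t^2}{4z_t}\Big).$$ Let $y_t=\max(\tilde y_t,0)$, predict $x_t=y_tw_t$, and receive $g_t$ and $\lambda_{t-1}$. 2. Set $h_{t+1}=\max(\lambda_{t-1}h_t,\|g_t\|)$ and $g_{t,\mathrm{clip}}=g_t\lambda_{t-1}h_t/h_{t+1}$ ($=0$ if $h_{t+1}=0$). 3. (Magnitude.) Let $c_t=\langle g_{t,\mathrm{clip}},w_t\rangle$; let $\tilde c_t=0$ if $c_t\tilde y_t<c_ty_t$ and $\tilde c_t=c_t$ otherwise. Set $v_{t+1}=\lambda_{t-1}^2v_t+\tilde c_t^2$ and $s_{t+1}=\lambda_{t-1}s_t-\tilde c_t$. 4. (Direction: discounted AdaGrad on the unit ball.) Let $Q_t=\sum_{i=1}^t\big(\prod_{j=i}^{t-1}\lambda_j^2\big)\|g_{i,\mathrm{clip}}\|^2$ and $w_{t+1}=\Pi\big(w_t-2Q_t^{-1/2}g_{t,\mathrm{clip}}\big)$ (no gradient step if $Q_t=0$), where $\Pi$ is the Euclidean projection onto the closed unit ball. \textbf{Theorem.} For every $\rho>1$ there is a constant $C_\rho$,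 depending only on $\rho$, and there is an absolute constant $C$ such that for all $d$, $\varepsilon>0$, $w_1$ with $\|w_1\|\le 1$, all $T\ge1$ and all plays of the above game over $T$ rounds against the algorithm, the following hold. For every $u\in\mathbb R^d$ with $\|u\|\ge\rho\,\varepsilon$, $$\mathrm{Regret}_T(u)\le C_\rho\max\Big(\|u\|\sqrt{V_T\log(\|u\|/\varepsilon)},\ \|u\|\,G_T\log(\|u\|/\varepsilon)\Big)+\Big(\max_{1\le t\le T}\|x_t\|\Big)G_T ,$$ and for $u=0$ $$\mathrm{Regret}_T(0)\le C\,\varepsilon\sqrt{V_T}+\Big(\max_{1\le t\le T}\|x_t\|\Big)G_T .$$ -/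

import Mathlib

noncomputable section

namespace DiscountedOCO

/-- Vectors of `ℝ^d` with the Euclidean norm. -/
abbrev Vec (d : ℕ) : Type := EuclideanSpace ℝ (Fin d)

/-! ### The discounted online convex optimization game

Rounds are numbered `1, 2, …`; the value of a sequence at index `0` is never used, except for the
discount factor `lam 0`, which is the one revealed in round `1`. -/

/-- `g` is a subgradient of `f` at `x`. -/
def IsSubgradient {d : ℕ} (f : Vec d → ℝ) (x g : Vec d) : Prop :=
  ∀ y : Vec d, f x + inner ℝ g (y - x) ≤ f y

/-- The discount weight `∏_{j=i}^{t-1} λ_j` (an empty product is `1`). -/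
def weight (lam : ℕ → ℝ) (i t : ℕ) : ℝ := ∏ j ∈ Finset.Ico i t, lam j

/-- The discounted regret `∑_{t=1}^T (∏_{i=t}^{T-1} λ_i) (l_t(x_t) - l_t(u))`. -/
def regret {d : ℕ} (lam : ℕ → ℝ) (l : ℕ → Vec d → ℝ) (x : ℕ → Vec d) (T : ℕ) (u : Vec d) : ℝ :=
  ∑ t ∈ Finset.Icc 1 T, weight lam t T * (l t (x t) - l t u)

/-- The discounted gradient variance `V_t = ∑_{i=1}^t (∏_{j=i}^{t-1} λ_j²) ‖g_i‖²`. -/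
def gradVar {d : ℕ} (lam : ℕ → ℝ) (g : ℕ → Vec d) (t : ℕ) : ℝ :=
  ∑ i ∈ Finset.Icc 1 t, (∏ j ∈ Finset.Ico i t, lam j ^ 2) * ‖g i‖ ^ 2

/-- `max_{i ∈ [1:t]} a_i`, for `t ≥ 1`. -/
def maxUpTo (a : ℕ → ℝ) (t : ℕ) : ℝ := sSup (a '' Set.Icc 1 t)

/-- The discounted Lipschitz constant `G_t = max_{i ∈ [1:t]} (∏_{j=i}^{t-1} λ_j) ‖g_i‖`. -/
def gradMax {d : ℕ} (lam : ℕ → ℝ) (g : ℕ → Vec d) (t : ℕ) : ℝ :=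
  maxUpTo (fun i => weight lam i t * ‖g i‖) t

/-! ### The one-dimensional magnitude learner -/

/-- The (rescaled) imaginary error function `∫_0^x exp(r²) dr`. -/
def erfi (x : ℝ) : ℝ := ∫ r in (0 : ℝ)..x, Real.exp (r ^ 2)

/-- The unprojected prediction of the magnitude learner with hyperparameter `ε`, from the hint `h`,
the discounted variance `v` and the discounted sum `s`. -/
def rawPred (ε h v s : ℝ) : ℝ :=
  if h = 0 then 0
  else
    ε * erfi (s / (2 * √(v + 2 * h * s + 16 * h ^ 2)))
      - ε * h / √(v + 2 * h * s + 16 * h ^ 2)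
        * Real.exp (s ^ 2 / (4 * (v + 2 * h * s + 16 * h ^ 2)))

/-- The prediction: the projection of the unprojected prediction to `[0, ∞)`. -/
def magPred (ε h v s : ℝ) : ℝ := max (rawPred ε h v s) 0

/-- The surrogate loss gradient obtained from the received gradient `c`. -/
def surrogate (ε h v s c : ℝ) : ℝ :=
  if c * rawPred ε h v s < c * magPred ε h v s then 0 else c

/-- The statistics `(v_t, s_t)` of the magnitude learner at the beginning of round `t`, when it is
given the discount factors `lam`, the hints `h` and the one-dimensional loss gradients `c`:
`v_1 = s_1 = 0`, `v_{t+1} = λ_{t-1}² v_t + c̃_t²`, `s_{t+1} = λ_{t-1} s_t - c̃_t`. -/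
def magState (ε : ℝ) (lam h c : ℕ → ℝ) : ℕ → ℝ × ℝ
  | 0 => (0, 0)
  | 1 => (0, 0)
  | t + 2 =>
    let v := (magState ε lam h c (t + 1)).1
    let s := (magState ε lam h c (t + 1)).2
    let c' := surrogate ε (h (t + 1)) v s (c (t + 1))
    (lam t ^ 2 * v + c' ^ 2, lam t * s - c')

/-- The prediction of the magnitude learner in round `t`. -/
def magnitude (ε : ℝ) (lam h c : ℕ → ℝ) (t : ℕ) : ℝ :=
  magPred ε (h t) (magState ε lam h c t).1 (magState ε lam h c t).2

/-! ### The direction learner: discounted AdaGrad on the unit ball -/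

/-- The Euclidean projection to the closed unit ball. -/
def projBall {d : ℕ} (x : Vec d) : Vec d := if ‖x‖ ≤ 1 then x else ‖x‖⁻¹ • x

/-- `projBall x` is the point of the closed unit ball that is nearest to `x`. -/
theorem projBall_spec {d : ℕ} (x : Vec d) :
    ‖projBall x‖ ≤ 1 ∧ ∀ y : Vec d, ‖y‖ ≤ 1 → ‖x - projBall x‖ ≤ ‖x - y‖ := by
  unfold projBall
  split_ifs with h
  · exact ⟨h, fun y _ => by simp⟩
  · have h0 : 0 < ‖x‖ := by linarith
    refine ⟨by simp [norm_smul, h0.ne'], fun y hy => ?_⟩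
    have e : x - ‖x‖⁻¹ • x = (1 - ‖x‖⁻¹) • x := by rw [sub_smul, one_smul]
    have h1 : ‖x‖⁻¹ ≤ 1 := inv_le_one_of_one_le₀ (by linarith)
    rw [e, norm_smul, Real.norm_of_nonneg (by linarith), sub_mul, inv_mul_cancel₀ h0.ne']
    have := norm_sub_norm_le x y
    linarith

/-- Projected online gradient descent on the unit ball (of diameter `D = 2`) on the gradients `g`,
started at `w₁`, with learning rate `η_t = D V_t^{-1/2}`, where `V_t` is the discounted variance of
these gradients: `w_{t+1} = Π (w_t - η_t g_t)`. When `V_t = 0` the gradient `g_t` is zero and so is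
the step. -/
def direction {d : ℕ} (lam : ℕ → ℝ) (g : ℕ → Vec d) (w₁ : Vec d) : ℕ → Vec d
  | 0 => w₁
  | 1 => w₁
  | t + 2 =>
    projBall (direction lam g w₁ (t + 1) - (2 / √(gradVar lam g (t + 1))) • g (t + 1))

/-! ### The combined algorithm on `ℝ^d` -/

/-- The hints `h_1 = 0`, `h_{t+1} = max (λ_{t-1} h_t) ‖g_t‖`. -/
def hint {d : ℕ} (lam : ℕ → ℝ) (g : ℕ → Vec d) : ℕ → ℝ
  | 0 => 0
  | 1 => 0
  | t + 2 => max (lam t * hint lam g (t + 1)) ‖g (t + 1)‖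

/-- The clipped gradients `g_t λ_{t-1} h_t / h_{t+1}`, and `0` if `h_{t+1} = 0`. -/
def clip {d : ℕ} (lam : ℕ → ℝ) (g : ℕ → Vec d) (t : ℕ) : Vec d :=
  if hint lam g (t + 1) = 0 then 0
  else (lam (t - 1) * hint lam g t / hint lam g (t + 1)) • g t

/-- The direction `w_t`: the direction learner is run on the clipped gradients. -/
def dirIterate {d : ℕ} (lam : ℕ → ℝ) (g : ℕ → Vec d) (w₁ : Vec d) (t : ℕ) : Vec d :=
  direction lam (clip lam g) w₁ t

/-- The magnitude `y_t`: the magnitude learner is run on the gradients `⟨g_{t,clip}, w_t⟩` with the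
hints of the combined algorithm. -/
def magIterate {d : ℕ} (ε : ℝ) (lam : ℕ → ℝ) (g : ℕ → Vec d) (w₁ : Vec d) (t : ℕ) : ℝ :=
  magnitude ε lam (hint lam g)
    (fun i => inner ℝ (clip lam g i) (dirIterate lam g w₁ i)) t

/-- The prediction `x_t = y_t w_t` of the combined algorithm with hyperparameter `ε`, whose direction
learner starts at `w₁`, on the gradients `g` and the discount factors `lam`. The value at `t` depends
only on `g_i` with `1 ≤ i < t` and `λ_i` with `i + 1 < t`. -/
def iterate {d : ℕ} (ε : ℝ) (lam : ℕ → ℝ) (g : ℕ → Vec d) (w₁ : Vec d) (t : ℕ) : Vec d :=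
  magIterate ε lam g w₁ t • dirIterate lam g w₁ t

/-- A play of the game over `T` rounds against the combined algorithm: the discount factors are
positive, and in every round `t` the loss `l_t` is convex on `ℝ^d` and `g_t` is a subgradient of
`l_t` at the prediction `x_t` of the algorithm. -/
structure IsPlay {d : ℕ} (ε : ℝ) (w₁ : Vec d) (T : ℕ) (lam : ℕ → ℝ) (l : ℕ → Vec d → ℝ)
    (g : ℕ → Vec d) : Prop where
  discount_pos : ∀ i < T, 0 < lam i
  convex : ∀ t ∈ Finset.Icc 1 T, ConvexOn ℝ Set.univ (l t)
  subgrad : ∀ t ∈ Finset.Icc 1 T, IsSubgradient (l t) (iterate ε lam g w₁ t) (g t)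

end DiscountedOCO

end

/-!
The algorithm multiplies the prediction `y_t ≥ 0` of a one-dimensional magnitude learner with the
iterate `w_t` of AdaGrad on the unit ball. After linearization of the losses by subgradients, the
regret against `u` splits (`regret_le`) into three parts.

* The error of clipping. Clipping `g_t` changes it by at most `h_{t+1} - λ_{t-1} h_t`, and these
  differences telescope, after discounting, to `h_{T+1} ≤ G_T` (`sum_clip_error_le`). This gives
  `(max ‖x_t‖ + ‖u‖) G_T`.
* `‖u‖` times the regret of AdaGrad against `u / ‖u‖`, at most `3 √V_T` (`direction_regret`).
* The regret of the magnitude learner against `‖u‖` (`magnitude_regret`).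

The magnitude learner plays, up to projection, the `s`-derivative of the potential
`Φ_h(v, s) = ε φ(v + 2 h s + 16 h², s)`, where `φ(z, s) = √z F(s / (2 √z))` and
`F(x) = 2 x erfi x - exp (x²)`. Since `∂_z φ = -∂_s² φ`, twice what the second-order term of a step
requires, and since the shift `2 h s + 16 h²` dominates the corrections, the map
`c ↦ Φ_h(v + c², s - c)` is concave for `|c| ≤ h` and `s - c ≥ 0` (`potential_update_le`). The
potential thus decreases by at least the loss of the round. It is homogeneous of degree one, which
handles the discounting, and decreasing in `h`, which handles the growth of the hints
(`magnitude_step`). The statistic `s` stays nonnegative because a negative prediction removes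
positive gradients, and a nonnegative one forces `s ≥ 2 h`.

What remains is to bound `s ‖u‖ - Φ_h(v, s)` uniformly in `s ≥ 0`. For `u = 0` this uses
`F x ≥ x² - 1` (`neg_potential_le`), and for `‖u‖ ≥ ρ ε` it uses `F x ≥ exp (x² / 2) - 2`
(`mul_sub_potential_le`), which confines `x = s / (2 √z)` to `O (√(log (‖u‖ / ε)))`.
-/

namespace DiscountedOCO

/-! ### The imaginary error function and the potential -/

theorem hasDerivAt_erfi (x : ℝ) : HasDerivAt erfi (Real.exp (x ^ 2)) x :=
  ((by fun_prop : Continuous fun r : ℝ => Real.exp (r ^ 2)).integral_hasStrictDerivAt 0 x).hasDerivAt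

theorem erfi_zero : erfi 0 = 0 := by simp [erfi]

/-- Comparison of two functions on `[0, ∞)` through their derivatives. -/
theorem le_of_hasDerivAt_le {f f' g g' : ℝ → ℝ} (h0 : f 0 ≤ g 0)
    (hf : ∀ x, HasDerivAt f (f' x) x) (hg : ∀ x, HasDerivAt g (g' x) x)
    (hle : ∀ x, 0 ≤ x → f' x ≤ g' x) {x : ℝ} (hx : 0 ≤ x) : f x ≤ g x := by
  have hd : ∀ x, HasDerivAt (fun x => g x - f x) (g' x - f' x) x := fun x => (hg x).sub (hf x)
  have hm : MonotoneOn (fun x => g x - f x) (Set.Ici 0) :=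
    monotoneOn_of_hasDerivWithinAt_nonneg (convex_Ici 0)
      (fun y _ => (hd y).continuousAt.continuousWithinAt)
      (fun y _ => (hd y).hasDerivWithinAt)
      (fun y hy => by
        rw [interior_Ici] at hy
        exact sub_nonneg.2 (hle y (le_of_lt hy)))
  have := hm (Set.mem_Ici.2 le_rfl) (Set.mem_Ici.2 hx) hx
  simp only at this
  linarith

theorem hasDerivAt_exp_sq (x : ℝ) :
    HasDerivAt (fun x : ℝ => Real.exp (x ^ 2)) (Real.exp (x ^ 2) * (2 * x)) x := by
  simpa using ((hasDerivAt_id x).pow 2).exp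

theorem hasDerivAt_exp_half_sq (x : ℝ) :
    HasDerivAt (fun x : ℝ => Real.exp (x ^ 2 / 2)) (Real.exp (x ^ 2 / 2) * x) x := by
  have h : HasDerivAt (fun x : ℝ => x ^ 2 / 2) x x := by
    simpa using (hasDerivAt_pow 2 x).div_const 2
  exact h.exp

theorem le_erfi {x : ℝ} (hx : 0 ≤ x) : x ≤ erfi x :=
  le_of_hasDerivAt_le (f := fun x => x) (by simp [erfi_zero]) (fun x => hasDerivAt_id x)
    hasDerivAt_erfi (fun x _ => Real.one_le_exp (sq_nonneg x)) hx

theorem erfi_le_mul_exp {x : ℝ} (hx : 0 ≤ x) : erfi x ≤ x * Real.exp (x ^ 2) :=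
  le_of_hasDerivAt_le (g := fun x => x * Real.exp (x ^ 2)) (by simp [erfi_zero]) hasDerivAt_erfi
    (fun x => (hasDerivAt_id x).mul (hasDerivAt_exp_sq x))
    (fun x _ => by
      simp only [id]
      nlinarith [mul_nonneg (Real.exp_pos (x ^ 2)).le (sq_nonneg x)]) hx

theorem mul_exp_half_sq_le_two_mul_erfi {x : ℝ} (hx : 0 ≤ x) :
    x * Real.exp (x ^ 2 / 2) ≤ 2 * erfi x :=
  le_of_hasDerivAt_le (f := fun x => x * Real.exp (x ^ 2 / 2)) (g := fun x => 2 * erfi x)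
    (by simp [erfi_zero])
    (fun x => (hasDerivAt_id x).mul (hasDerivAt_exp_half_sq x))
    (fun x => (hasDerivAt_erfi x).const_mul 2)
    (fun x _ => by
      simp only [id]
      have h1 := Real.add_one_le_exp (x ^ 2 / 2)
      have h2 : Real.exp (x ^ 2) = Real.exp (x ^ 2 / 2) * Real.exp (x ^ 2 / 2) := by
        rw [← Real.exp_add]; ring_nf
      rw [h2]
      nlinarith [Real.exp_pos (x ^ 2 / 2)]) hx

/-- The profile `F(x) = 2 x erfi x - exp (x²) = 2 ∫_0^x erfi - 1` of the potential. -/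
noncomputable def profile (x : ℝ) : ℝ := 2 * x * erfi x - Real.exp (x ^ 2)

theorem profile_zero : profile 0 = -1 := by simp [profile]

theorem hasDerivAt_profile (x : ℝ) : HasDerivAt profile (2 * erfi x) x := by
  have := (((hasDerivAt_id x).const_mul 2).mul (hasDerivAt_erfi x)).sub (hasDerivAt_exp_sq x)
  refine this.congr_deriv ?_
  simp only [id]; ring

theorem sq_sub_one_le_profile {x : ℝ} (hx : 0 ≤ x) : x ^ 2 - 1 ≤ profile x :=
  le_of_hasDerivAt_le (f := fun x => x ^ 2 - 1) (f' := fun x => 2 * x) (by simp [profile_zero])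
    (fun x => by simpa using ((hasDerivAt_id x).pow 2).sub_const 1)
    hasDerivAt_profile (fun x hx => by linarith [le_erfi hx]) hx

theorem exp_half_sq_sub_two_le_profile {x : ℝ} (hx : 0 ≤ x) :
    Real.exp (x ^ 2 / 2) - 2 ≤ profile x :=
  le_of_hasDerivAt_le (f := fun x => Real.exp (x ^ 2 / 2) - 2)
    (by norm_num [profile_zero])
    (fun x => (hasDerivAt_exp_half_sq x).sub_const 2)
    hasDerivAt_profile
    (fun x hx => by linarith [mul_exp_half_sq_le_two_mul_erfi hx]) hx

/-- The potential `φ(z, s) = √z F(s / (2 √z))`, a solution of the backward heat equation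
`∂_z φ + ∂_s² φ = 0`. -/
noncomputable def potential (z s : ℝ) : ℝ := √z * profile (s / (2 * √z))

theorem potential_zero_right (z : ℝ) : potential z 0 = -√z := by
  simp [potential, profile_zero]

theorem potential_smul {l : ℝ} (hl : 0 < l) (z s : ℝ) :
    potential (l ^ 2 * z) (l * s) = l * potential z s := by
  unfold potential
  rw [Real.sqrt_mul (sq_nonneg l), Real.sqrt_sq hl.le,
    show l * s / (2 * (l * √z)) = s / (2 * √z) by
      rw [show 2 * (l * √z) = l * (2 * √z) by ring, mul_div_mul_left _ _ hl.ne']]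
  ring

theorem hasDerivAt_div_sqrt {Z S : ℝ → ℝ} {Z' S' c : ℝ} (hZ : HasDerivAt Z Z' c)
    (hS : HasDerivAt S S' c) (hpos : 0 < Z c) :
    HasDerivAt (fun c => S c / (2 * √(Z c)))
      (S' / (2 * √(Z c)) - S c / (2 * √(Z c)) * (Z' / (2 * Z c))) c := by
  have hr : 0 < √(Z c) := Real.sqrt_pos.2 hpos
  refine (hS.div ((hZ.sqrt hpos.ne').const_mul 2) (by positivity)).congr_deriv ?_
  have hsq : Z c = √(Z c) ^ 2 := (Real.sq_sqrt hpos.le).symm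
  generalize √(Z c) = r at *
  rw [hsq]
  field_simp

theorem hasDerivAt_potential {Z S : ℝ → ℝ} {Z' S' c : ℝ} (hZ : HasDerivAt Z Z' c)
    (hS : HasDerivAt S S' c) (hpos : 0 < Z c) :
    HasDerivAt (fun c => potential (Z c) (S c))
      (S' * erfi (S c / (2 * √(Z c)))
        - Z' / (2 * √(Z c)) * Real.exp ((S c / (2 * √(Z c))) ^ 2)) c := by
  have hr : 0 < √(Z c) := Real.sqrt_pos.2 hpos
  have hx := hasDerivAt_div_sqrt hZ hS hpos
  have := (hZ.sqrt hpos.ne').mul ((hasDerivAt_profile _).comp c hx)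
  refine this.congr_deriv ?_
  simp only [Function.comp, profile]
  have hsq : Z c = √(Z c) ^ 2 := (Real.sq_sqrt hpos.le).symm
  generalize √(Z c) = r at *
  rw [hsq]
  field_simp
  ring

/-- The potential decreases in `z`, hence the learner's potential decreases as its hint grows. -/
theorem potential_anti {z z' s : ℝ} (hz : 0 < z) (hzz : z ≤ z') :
    potential z' s ≤ potential z s := by
  have hd : ∀ y ∈ Set.Ici z, HasDerivAt (fun y => potential y s) _ y := fun y hy =>
    hasDerivAt_potential (hasDerivAt_id y) (hasDerivAt_const y s) (lt_of_lt_of_le hz hy)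
  refine antitoneOn_of_hasDerivWithinAt_nonpos (convex_Ici z)
    (fun y hy => (hd y hy).continuousAt.continuousWithinAt)
    (fun y hy => (hd y (interior_subset hy)).hasDerivWithinAt) (fun y hy => ?_)
    (Set.mem_Ici.2 le_rfl) (Set.mem_Ici.2 hzz) hzz
  rw [zero_mul, zero_sub, neg_nonpos]
  positivity

/-! ### One step of the magnitude learner -/

theorem le_tangent_of_concaveOn {S : Set ℝ} {f : ℝ → ℝ} {f' x y : ℝ} (hf : ConcaveOn ℝ S f)
    (hx : x ∈ S) (hy : y ∈ S) (hd : HasDerivAt f f' x) : f y ≤ f x + f' * (y - x) := by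
  rcases lt_trichotomy x y with h | rfl | h
  · have := hf.slope_le_of_hasDerivAt hx hy h hd
    rw [slope_def_field, div_le_iff₀ (by linarith)] at this
    linarith
  · simp
  · have := hf.le_slope_of_hasDerivAt hy hx h hd
    rw [slope_def_field, le_div_iff₀ (by linarith)] at this
    linarith

/-- The argument `z = v + 2 h s + 16 h²` of the potential. -/
noncomputable def shifted (h v s : ℝ) : ℝ := v + 2 * h * s + 16 * h ^ 2

/-- Along the update `(v, s) ↦ (v + c², s - c)` the potential is concave in `c`, so that it lies
below its tangent at `c = 0`, whose slope is minus the prediction. -/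
theorem potential_update_le {h v s c : ℝ} (hh : 0 < h) (hv : 0 ≤ v) (hs : 0 ≤ s) (hc : |c| ≤ h)
    (hsc : 0 ≤ s - c) :
    potential (shifted h (v + c ^ 2) (s - c)) (s - c) ≤ potential (shifted h v s) s
      - c * (erfi (s / (2 * √(shifted h v s)))
        - h / √(shifted h v s) * Real.exp ((s / (2 * √(shifted h v s))) ^ 2)) := by
  set D : Set ℝ := Set.Icc (-h) (min h s)
  set Z : ℝ → ℝ := fun c => shifted h (v + c ^ 2) (s - c) with hZdef
  set S : ℝ → ℝ := fun c => s - c with hSdef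
  have hZ : ∀ c, HasDerivAt Z (2 * (c - h)) c := fun c => by
    have h1 : HasDerivAt (fun c : ℝ => v + c ^ 2 + 2 * h * (s - c) + 16 * h ^ 2)
        (2 * c + 2 * h * (-1)) c := by
      simpa using ((((hasDerivAt_id c).pow 2).const_add v).add
        (((hasDerivAt_id c).const_sub s).const_mul (2 * h))).add_const (16 * h ^ 2)
    exact h1.congr_deriv (by ring)
  have hS : ∀ c, HasDerivAt S (-1) c := fun c => (hasDerivAt_id c).const_sub s
  have hZlow : ∀ c ∈ D, 16 * h ^ 2 + 2 * h * S c ≤ Z c := fun c _ => by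
    simp only [hZdef, hSdef, shifted]
    nlinarith [sq_nonneg c]
  have hSnn : ∀ c ∈ D, 0 ≤ S c := fun c hc => by
    simp only [hSdef]; linarith [hc.2, min_le_right h s]
  have hZpos : ∀ c ∈ D, 0 < Z c := fun c hc => by
    have := hZlow c hc
    have := hSnn c hc
    have : 0 < 16 * h ^ 2 + 2 * h * S c := by positivity
    linarith
  have hd1 : ∀ c ∈ D, HasDerivAt (fun c => potential (Z c) (S c))
      ((h - c) / √(Z c) * Real.exp ((S c / (2 * √(Z c))) ^ 2) - erfi (S c / (2 * √(Z c)))) c :=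
    fun c hc => (hasDerivAt_potential (hZ c) (hS c) (hZpos c hc)).congr_deriv (by
      have : 0 < √(Z c) := Real.sqrt_pos.2 (hZpos c hc)
      field_simp
      ring)
  have hd2 : ∀ c ∈ D, HasDerivAt
      (fun c => (h - c) / √(Z c) * Real.exp ((S c / (2 * √(Z c))) ^ 2)
        - erfi (S c / (2 * √(Z c))))
      (Real.exp ((S c / (2 * √(Z c))) ^ 2) / √(Z c) *
        (-1 / 2 - 2 * (S c / (2 * √(Z c)) * ((h - c) / √(Z c)))
          + 2 * (S c / (2 * √(Z c)) * ((h - c) / √(Z c))) ^ 2 + ((h - c) / √(Z c)) ^ 2)) c := by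
    intro c hc
    have hp := hZpos c hc
    have hr : 0 < √(Z c) := Real.sqrt_pos.2 hp
    have hx := hasDerivAt_div_sqrt (hZ c) (hS c) hp
    have hq := ((hasDerivAt_id c).const_sub h).div ((hZ c).sqrt hp.ne') hr.ne'
    refine ((hq.mul ((hasDerivAt_exp_sq _).comp c hx)).sub
      ((hasDerivAt_erfi _).comp c hx)).congr_deriv ?_
    simp only [Function.comp, id, Pi.div_apply]
    have hsq : Z c = √(Z c) ^ 2 := (Real.sq_sqrt hp.le).symm
    generalize √(Z c) = r at *
    rw [hsq]
    field_simp
    ring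
  -- With `x = s / (2 √z)` and `q = (h - c) / √z`, the second derivative has the sign of
  -- `-1/2 - 2 x q + 2 (x q)² + q²`, where `0 ≤ x q ≤ 1` and `q² ≤ 1/4`.
  have hconc : ConcaveOn ℝ D (fun c => potential (Z c) (S c)) := by
    refine concaveOn_of_hasDerivWithinAt2_nonpos (convex_Icc _ _)
      (fun c hc => (hd1 c hc).continuousAt.continuousWithinAt)
      (fun c hc => (hd1 c (interior_subset hc)).hasDerivWithinAt)
      (fun c hc => (hd2 c (interior_subset hc)).hasDerivWithinAt) (fun c hc => ?_)
    have hcD := interior_subset hc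
    have hp := hZpos c hcD
    have hSc := hSnn c hcD
    have hlow := hZlow c hcD
    have hr : 0 < √(Z c) := Real.sqrt_pos.2 hp
    have hsq : √(Z c) ^ 2 = Z c := Real.sq_sqrt hp.le
    have hc1 : 0 ≤ h - c := by linarith [hcD.2, min_le_left h s]
    have hc2 : h - c ≤ 2 * h := by linarith [hcD.1]
    have hq : ((h - c) / √(Z c)) ^ 2 ≤ 1 / 4 := by
      rw [div_pow, hsq, div_le_iff₀ hp]
      nlinarith [mul_nonneg hh.le hSc]
    have hxq0 : 0 ≤ S c / (2 * √(Z c)) * ((h - c) / √(Z c)) := by positivity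
    have hxq1 : S c / (2 * √(Z c)) * ((h - c) / √(Z c)) ≤ 1 := by
      rw [div_mul_div_comm, div_le_one (by positivity)]
      nlinarith [mul_le_mul_of_nonneg_left hc2 hSc, sq_nonneg h]
    refine mul_nonpos_of_nonneg_of_nonpos (by positivity) ?_
    nlinarith
  have h0 : (0 : ℝ) ∈ D := ⟨by linarith, le_min hh.le hs⟩
  have hcD : c ∈ D := ⟨(abs_le.1 hc).1, le_min (abs_le.1 hc).2 (by linarith)⟩
  have key := le_tangent_of_concaveOn hconc h0 hcD (hd1 0 h0)
  have hZ0 : Z 0 = shifted h v s := by simp [hZdef]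
  have hS0 : S 0 = s := by simp [hSdef]
  simp only [hZ0, hS0, sub_zero] at key
  refine key.trans (le_of_eq ?_)
  ring

theorem shifted_nonneg {h v s : ℝ} (hh : 0 ≤ h) (hv : 0 ≤ v) (hs : 0 ≤ s) :
    0 ≤ shifted h v s := by unfold shifted; positivity

theorem shifted_pos {h v s : ℝ} (hh : 0 < h) (hv : 0 ≤ v) (hs : 0 ≤ s) :
    0 < shifted h v s := by unfold shifted; positivity

theorem rawPred_eq {ε h v s : ℝ} (hh : 0 < h) (hv : 0 ≤ v) (hs : 0 ≤ s) :
    rawPred ε h v s = ε * (erfi (s / (2 * √(shifted h v s)))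
        - h / √(shifted h v s) * Real.exp ((s / (2 * √(shifted h v s))) ^ 2)) := by
  have hz := shifted_nonneg hh.le hv hs
  rw [rawPred, if_neg hh.ne', div_pow, mul_pow, Real.sq_sqrt hz]
  simp only [shifted]
  norm_num
  ring

theorem rawPred_smul {ε h v s l : ℝ} (hl : 0 < l) (hh : 0 < h) (hv : 0 ≤ v) (hs : 0 ≤ s) :
    rawPred ε (l * h) (l ^ 2 * v) (l * s) = rawPred ε h v s := by
  rw [rawPred_eq hh hv hs, rawPred_eq (by positivity) (by positivity) (by positivity)]
  have e : shifted (l * h) (l ^ 2 * v) (l * s) = l ^ 2 * shifted h v s := by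
    simp only [shifted]; ring
  rw [e, Real.sqrt_mul (sq_nonneg l), Real.sqrt_sq hl.le, mul_div_mul_left _ _ hl.ne',
    show l * s / (2 * (l * √(shifted h v s))) = s / (2 * √(shifted h v s)) by
      rw [mul_left_comm, mul_div_mul_left _ _ hl.ne']]

/-- The unprojected prediction is negative unless `s ≥ 2 h`. Since the surrogate gradient is never
positive when the prediction is negative, this keeps the statistic `s` nonnegative. -/
theorem two_mul_le_of_rawPred_nonneg {ε h v s : ℝ} (hε : 0 < ε) (hh : 0 < h) (hv : 0 ≤ v)
    (hs : 0 ≤ s) (hp : 0 ≤ rawPred ε h v s) : 2 * h ≤ s := by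
  have hr : 0 < √(shifted h v s) := Real.sqrt_pos.2 (shifted_pos hh hv hs)
  rw [rawPred_eq hh hv hs] at hp
  have h1 := nonneg_of_mul_nonneg_right hp hε
  have h2 := erfi_le_mul_exp (x := s / (2 * √(shifted h v s))) (by positivity)
  have h3 : h / √(shifted h v s) ≤ s / (2 * √(shifted h v s)) :=
    le_of_mul_le_mul_right (by linarith)
      (Real.exp_pos ((s / (2 * √(shifted h v s))) ^ 2))
  rw [div_le_div_iff₀ hr (by positivity)] at h3
  nlinarith

theorem surrogate_eq (ε h v s c : ℝ) :
    surrogate ε h v s c = 0 ∨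
      surrogate ε h v s c = c ∧ (0 < c → 0 ≤ rawPred ε h v s) := by
  unfold surrogate
  split_ifs with hlt
  · exact Or.inl rfl
  · refine Or.inr ⟨rfl, fun hc => ?_⟩
    by_contra hneg
    apply hlt
    rw [magPred, max_eq_right (by linarith)]
    nlinarith

theorem mul_magPred_sub_le {U : ℝ} (hU : 0 ≤ U) (ε h v s c : ℝ) :
    c * (magPred ε h v s - U) ≤ surrogate ε h v s c * (rawPred ε h v s - U) := by
  unfold surrogate
  split_ifs with hlt
  · rcases le_total 0 (rawPred ε h v s) with hp | hp
    · rw [magPred, max_eq_left hp] at hlt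
      exact absurd hlt (lt_irrefl _)
    · rw [magPred, max_eq_right hp] at hlt ⊢
      have hc : 0 ≤ c := by
        by_contra hc
        nlinarith
      nlinarith
  · nlinarith

/-- One round of the magnitude learner with surrogate gradient `c`: the statistic `s` stays
nonnegative, and the discounted potential decreases by at least the surrogate loss. -/
theorem magnitude_step {ε l h h' v s c : ℝ} (hε : 0 < ε) (hl : 0 < l) (hh : 0 ≤ h) (hv : 0 ≤ v)
    (hs : 0 ≤ s) (h0 : h = 0 → v = 0 ∧ s = 0) (hc : |c| ≤ l * h) (hh' : l * h ≤ h')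
    (hp : 0 < c → 0 ≤ rawPred ε h v s) :
    0 ≤ l * s - c ∧ (h' = 0 → l ^ 2 * v + c ^ 2 = 0 ∧ l * s - c = 0) ∧
      ε * potential (shifted h' (l ^ 2 * v + c ^ 2) (l * s - c)) (l * s - c) ≤
        l * (ε * potential (shifted h v s) s) - c * rawPred ε h v s := by
  rcases hh.eq_or_lt with rfl | hpos
  · obtain ⟨rfl, rfl⟩ := h0 rfl
    have hc0 : c = 0 := by simpa using hc
    subst hc0
    refine ⟨by simp, fun _ => by simp, ?_⟩
    simp only [mul_zero, sub_zero, potential_zero_right, shifted]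
    norm_num
    positivity
  · have hlh : 0 < l * h := by positivity
    have hsc : 0 ≤ l * s - c := by
      rcases le_or_gt c 0 with hc0 | hc0
      · have : 0 ≤ l * s := by positivity
        linarith
      · have := two_mul_le_of_rawPred_nonneg hε hpos hv hs (hp hc0)
        have := (abs_le.1 hc).2
        nlinarith
    refine ⟨hsc, fun h0 => by linarith, ?_⟩
    have hv' : 0 ≤ l ^ 2 * v := by positivity
    have hs' : 0 ≤ l * s := by positivity
    have hstep := potential_update_le hlh hv' hs' hc hsc
    have hz : shifted (l * h) (l ^ 2 * v) (l * s) = l ^ 2 * shifted h v s := by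
      simp only [shifted]; ring
    have hanti : potential (shifted h' (l ^ 2 * v + c ^ 2) (l * s - c)) (l * s - c) ≤
        potential (shifted (l * h) (l ^ 2 * v + c ^ 2) (l * s - c)) (l * s - c) := by
      refine potential_anti (shifted_pos hlh (by positivity) hsc) ?_
      unfold shifted
      gcongr
    have hpred := rawPred_eq (ε := ε) hlh hv' hs'
    rw [rawPred_smul hl hpos hv hs] at hpred
    rw [hpred]
    have := mul_le_mul_of_nonneg_left (hanti.trans hstep) hε.le
    rw [show potential (shifted (l * h) (l ^ 2 * v) (l * s)) (l * s) =
      l * potential (shifted h v s) s by rw [hz, potential_smul hl]] at this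
    linarith

/-! ### Discounted sums and the regret of the magnitude learner -/

theorem discounted_sum_succ (lam a : ℕ → ℝ) (T : ℕ) :
    ∑ i ∈ Finset.Icc 1 (T + 1), weight lam i (T + 1) * a i =
      lam T * ∑ i ∈ Finset.Icc 1 T, weight lam i T * a i + a (T + 1) := by
  rw [Finset.sum_Icc_succ_top (by omega), Finset.mul_sum]
  congr 1
  · refine Finset.sum_congr rfl fun i hi => ?_
    rw [weight, Finset.prod_Ico_succ_top (Finset.mem_Icc.1 hi).2, ← weight]
    ring
  · simp [weight]

theorem weight_nonneg {lam : ℕ → ℝ} {T : ℕ} (hlam : ∀ t < T, 0 < lam t) (i : ℕ) :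
    0 ≤ weight lam i T :=
  Finset.prod_nonneg fun j hj => (hlam j (Finset.mem_Ico.1 hj).2).le

theorem magState_succ (ε : ℝ) (lam h c : ℕ → ℝ) (t : ℕ) :
    magState ε lam h c (t + 2) =
      (lam t ^ 2 * (magState ε lam h c (t + 1)).1
        + surrogate ε (h (t + 1)) (magState ε lam h c (t + 1)).1 (magState ε lam h c (t + 1)).2
            (c (t + 1)) ^ 2,
      lam t * (magState ε lam h c (t + 1)).2
        - surrogate ε (h (t + 1)) (magState ε lam h c (t + 1)).1 (magState ε lam h c (t + 1)).2
            (c (t + 1))) := rfl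

/-- The discounted regret of the magnitude learner against `U ≥ 0`, in terms of the potential at its
final statistics, together with the invariants that these statistics satisfy. -/
theorem magnitude_regret {ε U : ℝ} {lam h c : ℕ → ℝ} (hε : 0 < ε) (hU : 0 ≤ U) (h1 : h 1 = 0)
    (T : ℕ) (hlam : ∀ t < T, 0 < lam t) (hh : ∀ t < T, lam t * h (t + 1) ≤ h (t + 2))
    (hc : ∀ t < T, |c (t + 1)| ≤ lam t * h (t + 1)) :
    let v := (magState ε lam h c (T + 1)).1
    let s := (magState ε lam h c (T + 1)).2
    0 ≤ h (T + 1) ∧ 0 ≤ v ∧ 0 ≤ s ∧ (h (T + 1) = 0 → v = 0 ∧ s = 0) ∧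
      v ≤ ∑ t ∈ Finset.Icc 1 T, weight (fun j => lam j ^ 2) t T * c t ^ 2 ∧
      ∑ t ∈ Finset.Icc 1 T, weight lam t T * (c t * (magnitude ε lam h c t - U)) ≤
        s * U - ε * potential (shifted (h (T + 1)) v s) s := by
  induction T with
  | zero => simp [magState, h1, shifted, potential_zero_right]
  | succ T ih =>
    obtain ⟨ihh, ihv, ihs, ih0, ihvle, ihreg⟩ := ih (fun t ht => hlam t (by omega))
      (fun t ht => hh t (by omega)) (fun t ht => hc t (by omega))
    have hl := hlam T (by omega)
    have hhT := hh T (by omega)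
    have hcT := hc T (by omega)
    rw [discounted_sum_succ, discounted_sum_succ, show T + 1 + 1 = T + 2 from rfl, magState_succ]
    have hreg := mul_magPred_sub_le hU ε (h (T + 1)) (magState ε lam h c (T + 1)).1
      (magState ε lam h c (T + 1)).2 (c (T + 1))
    have hsur := surrogate_eq ε (h (T + 1)) (magState ε lam h c (T + 1)).1
      (magState ε lam h c (T + 1)).2 (c (T + 1))
    rw [magnitude]
    generalize (magState ε lam h c (T + 1)).1 = v at *
    generalize (magState ε lam h c (T + 1)).2 = s at *
    generalize surrogate ε (h (T + 1)) v s (c (T + 1)) = c' at *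
    have hc' : |c'| ≤ lam T * h (T + 1) ∧ (0 < c' → 0 ≤ rawPred ε (h (T + 1)) v s) ∧
        c' ^ 2 ≤ c (T + 1) ^ 2 := by
      rcases hsur with rfl | ⟨rfl, hp⟩
      · simp only [abs_zero, lt_irrefl, false_imp_iff, true_and]
        exact ⟨by positivity, by simpa using sq_nonneg (c (T + 1))⟩
      · exact ⟨hcT, hp, le_rfl⟩
    obtain ⟨hs', h0', hpot⟩ := magnitude_step hε hl ihh ihv ihs ih0 hc'.1 hhT hc'.2.1
    dsimp only
    refine ⟨le_trans (by positivity) hhT, by positivity, hs', h0', ?_, ?_⟩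
    · have := mul_le_mul_of_nonneg_left ihvle (sq_nonneg (lam T))
      linarith [hc'.2.2]
    · have := mul_le_mul_of_nonneg_left ihreg hl.le
      linarith

/-! ### Conjugate bounds for the potential -/

/-- If `s ≤ 2 x √z`, then `r = √z` satisfies `r² ≤ V + 4 h x r + 16 h²`, which bounds `r`. -/
theorem sqrt_shifted_le {h v s V : ℝ} (hh : 0 ≤ h) (hv : 0 ≤ v) (hs : 0 ≤ s) (hvV : v ≤ V)
    {x : ℝ} (hx : 0 ≤ x) (hsx : s ≤ 2 * x * √(shifted h v s)) :
    √(shifted h v s) ≤ 4 * h * x + √V + 4 * h := by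
  have hz := shifted_nonneg hh hv hs
  have hr := Real.sqrt_nonneg (shifted h v s)
  have hsq : √(shifted h v s) ^ 2 = v + 2 * h * s + 16 * h ^ 2 := Real.sq_sqrt hz
  have hV := Real.sq_sqrt (hv.trans hvV)
  have hV0 := Real.sqrt_nonneg V
  generalize √(shifted h v s) = r at *
  generalize √V = b at *
  have h1 : 2 * h * s ≤ 4 * h * x * r := by nlinarith
  by_contra! hlt
  have h2 : 0 ≤ h * x := by positivity
  nlinarith [mul_nonneg hh hV0]

/-- The parametrization `s = 2 x √z` also holds at `z = 0`, where `s = 0` and the quotient defining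
`x` has a zero denominator. -/
theorem eq_two_mul_sqrt_shifted {h v s : ℝ} (hh : 0 ≤ h) (hv : 0 ≤ v) (hs : 0 ≤ s)
    (h0 : h = 0 → s = 0) : s = 2 * (s / (2 * √(shifted h v s))) * √(shifted h v s) := by
  rcases hh.eq_or_lt with rfl | hpos
  · simp [h0 rfl]
  · have hr : 0 < √(shifted h v s) := Real.sqrt_pos.2 (shifted_pos hpos hv hs)
    field_simp

/-- The negative of the potential can only be positive when `s < 2 √z`, since `F ≥ 0` on `[1, ∞)`;
in that range `√z` is of order `√V`. -/
theorem neg_potential_le {h v s V : ℝ} (hh : 0 ≤ h) (hv : 0 ≤ v) (hs : 0 ≤ s)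
    (h0 : h = 0 → s = 0) (hvV : v ≤ V) (hhV : h ^ 2 ≤ V) :
    -potential (shifted h v s) s ≤ 9 * √V := by
  have hsx := eq_two_mul_sqrt_shifted hh hv hs h0
  have hF := sq_sub_one_le_profile (x := s / (2 * √(shifted h v s))) (by positivity)
  have hx : 0 ≤ s / (2 * √(shifted h v s)) := by positivity
  have hr := Real.sqrt_nonneg (shifted h v s)
  have hhV' : h ≤ √V := Real.le_sqrt_of_sq_le hhV
  unfold potential
  generalize s / (2 * √(shifted h v s)) = x at *
  rcases le_or_gt 1 x with h1 | h1
  · have : 0 ≤ √(shifted h v s) * profile x := mul_nonneg hr (by nlinarith)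
    linarith [Real.sqrt_nonneg V]
  · have hb := sqrt_shifted_le hh hv hs hvV zero_le_one (by nlinarith)
    nlinarith [mul_nonneg hr (sq_nonneg x)]

/-- The Fenchel conjugate of the potential at `U = ε exp (b²)`, that is, with `b = √(log (U / ε))`.
For `x = s / (2 √z) ≥ (5 κ + 2) b` the growth of the profile makes the left-hand side nonpositive,
and for smaller `x` both `s` and `z` are under control. -/
theorem mul_sub_potential_le {ε b κ h v s V : ℝ} (hε : 0 < ε) (hb : 0 ≤ b) (hκ : 0 ≤ κ)
    (hκb : 1 ≤ κ * b) (hh : 0 ≤ h) (hv : 0 ≤ v) (hs : 0 ≤ s) (h0 : h = 0 → s = 0) (hvV : v ≤ V) :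
    s * (ε * Real.exp (b ^ 2)) - ε * potential (shifted h v s) s ≤
      ε * Real.exp (b ^ 2) * ((2 * (5 * κ + 2) + κ) * b *
        (4 * (5 * κ + 2 + κ) * (h * b) + √V)) := by
  have hsx := eq_two_mul_sqrt_shifted hh hv hs h0
  have hF1 := sq_sub_one_le_profile (x := s / (2 * √(shifted h v s))) (by positivity)
  have hF2 := exp_half_sq_sub_two_le_profile (x := s / (2 * √(shifted h v s))) (by positivity)
  have hx : 0 ≤ s / (2 * √(shifted h v s)) := by positivity
  have hr := Real.sqrt_nonneg (shifted h v s)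
  have hV := Real.sqrt_nonneg V
  have hU : 1 ≤ Real.exp (b ^ 2) := Real.one_le_exp (sq_nonneg b)
  unfold potential
  generalize s / (2 * √(shifted h v s)) = x at *
  have e : s * (ε * Real.exp (b ^ 2)) - ε * (√(shifted h v s) * profile x) =
      ε * (√(shifted h v s) * (2 * x * Real.exp (b ^ 2) - profile x)) := by
    linear_combination (ε * Real.exp (b ^ 2)) * hsx
  rw [e, mul_assoc ε]
  refine mul_le_mul_of_nonneg_left ?_ hε.le
  have hrhs : 0 ≤ Real.exp (b ^ 2) * ((2 * (5 * κ + 2) + κ) * b *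
        (4 * (5 * κ + 2 + κ) * (h * b) + √V)) := by positivity
  rcases le_or_gt ((5 * κ + 2) * b) x with hxb | hxb
  · have hx5 : 5 ≤ x := by nlinarith
    have hx2 : 2 * b ≤ x := by nlinarith
    have h1 : Real.exp (b ^ 2) ≤ Real.exp (x ^ 2 / 4) := Real.exp_le_exp.2 (by nlinarith)
    have h2 : 2 * x + 2 ≤ Real.exp (x ^ 2 / 4) := by
      have := Real.quadratic_le_exp_of_nonneg (x := x ^ 2 / 4) (by positivity)
      nlinarith [mul_nonneg (sub_nonneg.2 hx5) (sub_nonneg.2 hx5)]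
    have h3 : Real.exp (x ^ 2 / 2) = Real.exp (x ^ 2 / 4) * Real.exp (x ^ 2 / 4) := by
      rw [← Real.exp_add]; ring_nf
    have h4 : Real.exp (b ^ 2) * (2 * x + 2) ≤ Real.exp (x ^ 2 / 2) := by
      rw [h3]
      exact mul_le_mul h1 h2 (by linarith) (by positivity)
    refine le_trans (mul_nonpos_of_nonneg_of_nonpos hr ?_) hrhs
    nlinarith
  · have hz := sqrt_shifted_le hh hv hs hvV (x := (5 * κ + 2) * b) (by positivity) (by
      conv_lhs => rw [hsx]
      gcongr)
    have h1 : 2 * x * Real.exp (b ^ 2) - profile x ≤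
        Real.exp (b ^ 2) * ((2 * (5 * κ + 2) + κ) * b) := by
      have : x * Real.exp (b ^ 2) ≤ (5 * κ + 2) * b * Real.exp (b ^ 2) := by gcongr
      nlinarith [sq_nonneg x]
    have h2 : √(shifted h v s) ≤ 4 * (5 * κ + 2 + κ) * (h * b) + √V := by nlinarith
    calc √(shifted h v s) * (2 * x * Real.exp (b ^ 2) - profile x)
        ≤ √(shifted h v s) * (Real.exp (b ^ 2) * ((2 * (5 * κ + 2) + κ) * b)) := by gcongr
      _ ≤ (4 * (5 * κ + 2 + κ) * (h * b) + √V) *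
          (Real.exp (b ^ 2) * ((2 * (5 * κ + 2) + κ) * b)) := by gcongr
      _ = _ := by ring

/-! ### The regret of the direction learner -/

theorem norm_projBall_sub_sq_le {d : ℕ} (x : Vec d) {u : Vec d} (hu : ‖u‖ ≤ 1) :
    ‖projBall x - u‖ ^ 2 ≤ ‖x - u‖ ^ 2 := by
  unfold projBall
  split_ifs with h
  · exact le_rfl
  · have h0 : 0 < ‖x‖ := by linarith
    have hin : inner ℝ x u ≤ ‖x‖ := (real_inner_le_norm x u).trans (by nlinarith)
    rw [norm_sub_sq_real, norm_sub_sq_real, norm_smul, norm_inv, norm_norm,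
      inv_mul_cancel₀ h0.ne', real_inner_smul_left]
    have hp : ‖x‖⁻¹ * inner ℝ x u ≤ 1 := by rwa [inv_mul_le_iff₀ h0, mul_one]
    have e : inner ℝ x u = ‖x‖ * (‖x‖⁻¹ * inner ℝ x u) := by field_simp
    rw [e]
    generalize ‖x‖⁻¹ * inner ℝ x u = p at *
    rw [inv_mul_cancel_left₀ h0.ne']
    nlinarith

theorem norm_direction_le_one {d : ℕ} {lam : ℕ → ℝ} {γ : ℕ → Vec d} {w₁ : Vec d}
    (hw : ‖w₁‖ ≤ 1) : ∀ t, ‖direction lam γ w₁ t‖ ≤ 1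
  | 0 => hw
  | 1 => hw
  | _ + 2 => (projBall_spec _).1

theorem gradVar_succ {d : ℕ} (lam : ℕ → ℝ) (g : ℕ → Vec d) (T : ℕ) :
    gradVar lam g (T + 1) = lam T ^ 2 * gradVar lam g T + ‖g (T + 1)‖ ^ 2 :=
  discounted_sum_succ (fun j => lam j ^ 2) (fun i => ‖g i‖ ^ 2) T

theorem gradVar_nonneg {d : ℕ} (lam : ℕ → ℝ) (g : ℕ → Vec d) (T : ℕ) : 0 ≤ gradVar lam g T :=
  Finset.sum_nonneg fun _ _ =>
    mul_nonneg (Finset.prod_nonneg fun _ _ => sq_nonneg _) (sq_nonneg _)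

/-- The discounted regret of AdaGrad on the unit ball is at most `3 √Q_T`. The distance from the
last iterate to the comparator is kept in the bound to make the induction work. -/
theorem direction_regret {d : ℕ} {lam : ℕ → ℝ} {γ : ℕ → Vec d} {w₁ u : Vec d} (hw : ‖w₁‖ ≤ 1)
    (hu : ‖u‖ ≤ 1) (T : ℕ) (hlam : ∀ t < T, 0 < lam t) :
    ∑ t ∈ Finset.Icc 1 T, weight lam t T * inner ℝ (γ t) (direction lam γ w₁ t - u) ≤
      √(gradVar lam γ T) * (3 - ‖direction lam γ w₁ (T + 1) - u‖ ^ 2 / 4) := by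
  induction T with
  | zero => simp [gradVar]
  | succ T ih =>
    have ih := ih fun t ht => hlam t (by omega)
    have hl := hlam T (by omega)
    rw [discounted_sum_succ]
    set w := direction lam γ w₁ (T + 1) with hwdef
    set b := √(gradVar lam γ (T + 1)) with hb
    have hb0 : 0 ≤ b := Real.sqrt_nonneg _
    have hbsq : b ^ 2 = (lam T * √(gradVar lam γ T)) ^ 2 + ‖γ (T + 1)‖ ^ 2 := by
      rw [hb, Real.sq_sqrt (gradVar_nonneg _ _ _), mul_pow, Real.sq_sqrt (gradVar_nonneg _ _ _),
        gradVar_succ]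
    have ha0 : 0 ≤ lam T * √(gradVar lam γ T) := by positivity
    have ih' := mul_le_mul_of_nonneg_left ih hl.le
    rw [← mul_assoc] at ih'
    generalize lam T * √(gradVar lam γ T) = a at *
    have hD : ‖w - u‖ ^ 2 ≤ 4 := by
      have h1 : ‖w - u‖ ≤ 2 := by
        have := norm_direction_le_one (lam := lam) (γ := γ) hw (T + 1)
        linarith [norm_sub_le w u]
      nlinarith [norm_nonneg (w - u)]
    have hnext : direction lam γ w₁ (T + 1 + 1) = projBall (w - (2 / b) • γ (T + 1)) := rfl
    rcases hb0.eq_or_lt with h0 | hpos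
    · rw [← h0] at hbsq ⊢
      have hγ : γ (T + 1) = 0 := by
        rw [← norm_eq_zero]
        exact pow_eq_zero_iff two_ne_zero |>.1 (by nlinarith [sq_nonneg a, sq_nonneg ‖γ (T + 1)‖])
      have ha : a = 0 := pow_eq_zero_iff two_ne_zero |>.1
        (by nlinarith [sq_nonneg a, sq_nonneg ‖γ (T + 1)‖])
      simpa [hγ, ha] using ih'
    · have hstep := norm_projBall_sub_sq_le (w - (2 / b) • γ (T + 1)) hu
      rw [← hnext, show w - (2 / b) • γ (T + 1) - u = (w - u) - (2 / b) • γ (T + 1) by abel,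
        norm_sub_sq_real (w - u), real_inner_smul_right, norm_smul, mul_pow, Real.norm_eq_abs,
        sq_abs, real_inner_comm (γ (T + 1)) (w - u)] at hstep
      have hbb : b / 4 * (2 / b * inner ℝ (γ (T + 1)) (w - u)) * 2 = inner ℝ (γ (T + 1)) (w - u) := by
        field_simp
        norm_num
      have hcc : b / 4 * ((2 / b) ^ 2 * ‖γ (T + 1)‖ ^ 2) = ‖γ (T + 1)‖ ^ 2 / b := by
        field_simp
        norm_num
      have hstep' := mul_le_mul_of_nonneg_left hstep (by positivity : 0 ≤ b / 4)
      have hab : a ≤ b := by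
        by_contra! hlt
        nlinarith [sq_nonneg ‖γ (T + 1)‖]
      have hlast : ‖γ (T + 1)‖ ^ 2 / b ≤ 2 * (b - a) := by
        rw [div_le_iff₀ hpos]
        nlinarith [sq_nonneg (b - a)]
      nlinarith [mul_le_mul_of_nonneg_left hD (sub_nonneg.2 hab)]

/-! ### Hints and clipped gradients -/

theorem hint_succ {d : ℕ} (lam : ℕ → ℝ) (g : ℕ → Vec d) (t : ℕ) :
    hint lam g (t + 2) = max (lam t * hint lam g (t + 1)) ‖g (t + 1)‖ := rfl

theorem hint_nonneg {d : ℕ} (lam : ℕ → ℝ) (g : ℕ → Vec d) : ∀ t, 0 ≤ hint lam g t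
  | 0 => le_rfl
  | 1 => le_rfl
  | _ + 2 => (norm_nonneg _).trans (le_max_right _ _)

theorem hint_sq_le_gradVar {d : ℕ} (lam : ℕ → ℝ) (g : ℕ → Vec d) (T : ℕ) :
    hint lam g (T + 1) ^ 2 ≤ gradVar lam g T := by
  induction T with
  | zero => simp [hint, gradVar]
  | succ T ih =>
    rw [hint_succ, gradVar_succ]
    have h1 := mul_le_mul_of_nonneg_left ih (sq_nonneg (lam T))
    rcases max_choice (lam T * hint lam g (T + 1)) ‖g (T + 1)‖ with h | h <;> rw [h]
    · nlinarith [sq_nonneg ‖g (T + 1)‖]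
    · nlinarith [mul_nonneg (sq_nonneg (lam T)) (gradVar_nonneg lam g T)]

theorem le_maxUpTo (a : ℕ → ℝ) {t T : ℕ} (ht : t ∈ Finset.Icc 1 T) : a t ≤ maxUpTo a T :=
  le_csSup ((Set.finite_Icc 1 T).image a).bddAbove
    ⟨t, by simpa using ht, rfl⟩

theorem hint_le_gradMax {d : ℕ} (lam : ℕ → ℝ) (g : ℕ → Vec d) {T : ℕ} (hT : 1 ≤ T) :
    hint lam g (T + 1) ≤ gradMax lam g T := by
  have key : ∃ i ∈ Finset.Icc 1 T, hint lam g (T + 1) = weight lam i T * ‖g i‖ := by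
    induction T, hT using Nat.le_induction with
    | base => exact ⟨1, by simp, by simp [hint, weight]⟩
    | succ T hT ih =>
      obtain ⟨i, hi, hieq⟩ := ih
      rw [Finset.mem_Icc] at hi
      rw [hint_succ, hieq]
      rcases max_choice (lam T * (weight lam i T * ‖g i‖)) ‖g (T + 1)‖ with h | h <;> rw [h]
      · refine ⟨i, Finset.mem_Icc.2 ⟨hi.1, by omega⟩, ?_⟩
        rw [weight, weight, Finset.prod_Ico_succ_top hi.2]
        ring
      · exact ⟨T + 1, by simp, by simp [weight]⟩
  obtain ⟨i, hi, h⟩ := key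
  rw [h]
  exact le_maxUpTo (fun i => weight lam i T * ‖g i‖) hi

theorem clip_succ_bounds {d : ℕ} {lam : ℕ → ℝ} (g : ℕ → Vec d) {t : ℕ} (hl : 0 < lam t) :
    ‖clip lam g (t + 1)‖ ≤ lam t * hint lam g (t + 1) ∧
      ‖clip lam g (t + 1)‖ ≤ ‖g (t + 1)‖ ∧
      ‖g (t + 1) - clip lam g (t + 1)‖ ≤ hint lam g (t + 2) - lam t * hint lam g (t + 1) := by
  have hg : ‖g (t + 1)‖ ≤ hint lam g (t + 2) := le_max_right _ _
  have hh : lam t * hint lam g (t + 1) ≤ hint lam g (t + 2) := le_max_left _ _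
  have h0 : 0 ≤ lam t * hint lam g (t + 1) := mul_nonneg hl.le (hint_nonneg _ _ _)
  rw [clip, show t + 1 + 1 = t + 2 from rfl, show t + 1 - 1 = t from rfl]
  split_ifs with hz
  · rw [hz] at hg hh ⊢
    simp only [norm_zero, sub_zero]
    exact ⟨h0, norm_nonneg _, by linarith⟩
  · have hpos : 0 < hint lam g (t + 2) := lt_of_le_of_ne (hint_nonneg _ _ _) (Ne.symm hz)
    generalize lam t * hint lam g (t + 1) = a at *
    generalize hint lam g (t + 2) = b at *
    have hab0 : 0 ≤ a / b := by positivity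
    have hab1 : a / b ≤ 1 := (div_le_one hpos).2 hh
    have e : g (t + 1) - (a / b) • g (t + 1) = (1 - a / b) • g (t + 1) := by
      rw [sub_smul, one_smul]
    have eab : a / b * b = a := by field_simp
    rw [e, norm_smul, norm_smul, Real.norm_of_nonneg hab0, Real.norm_of_nonneg (by linarith)]
    refine ⟨?_, ?_, ?_⟩ <;> nlinarith [norm_nonneg (g (t + 1))]

/-- Replacing the gradients by the clipped gradients costs at most the last hint: the errors
telescope. -/
theorem sum_clip_error_le {d : ℕ} {lam : ℕ → ℝ} (g : ℕ → Vec d) (T : ℕ)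
    (hlam : ∀ t < T, 0 < lam t) :
    ∑ t ∈ Finset.Icc 1 T, weight lam t T * ‖g t - clip lam g t‖ ≤ hint lam g (T + 1) := by
  induction T with
  | zero => simp [hint]
  | succ T ih =>
    have hl := hlam T (by omega)
    have := mul_le_mul_of_nonneg_left (ih fun t ht => hlam t (by omega)) hl.le
    rw [discounted_sum_succ]
    linarith [(clip_succ_bounds g hl).2.2]

/-! ### The regret of the combined algorithm -/

/-- The regret splits into the clipping error, the regret of the magnitude learner against `‖u‖`,
and `‖u‖` times the regret of the direction learner against `u / ‖u‖`. -/
theorem regret_le {d : ℕ} {ε : ℝ} {w₁ : Vec d} {T : ℕ} {lam : ℕ → ℝ} {l : ℕ → Vec d → ℝ}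
    {g : ℕ → Vec d} (hε : 0 < ε) (hw : ‖w₁‖ ≤ 1) (hT : 1 ≤ T) (hplay : IsPlay ε w₁ T lam l g)
    (u : Vec d) :
    ∃ v s : ℝ, 0 ≤ v ∧ 0 ≤ s ∧ (hint lam g (T + 1) = 0 → s = 0) ∧ v ≤ gradVar lam g T ∧
      regret lam l (iterate ε lam g w₁) T u ≤
        (s * ‖u‖ - ε * potential (shifted (hint lam g (T + 1)) v s) s)
          + ‖u‖ * (3 * √(gradVar lam g T) + hint lam g (T + 1))
          + maxUpTo (fun t => ‖iterate ε lam g w₁ t‖) T * gradMax lam g T := by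
  have hlam := hplay.discount_pos
  set w : ℕ → Vec d := dirIterate lam g w₁ with hwdef
  set c : ℕ → ℝ := fun i => inner ℝ (clip lam g i) (w i) with hcdef
  set x : ℕ → Vec d := iterate ε lam g w₁ with hxdef
  set M := maxUpTo (fun t => ‖x t‖) T with hM
  set û : Vec d := ‖u‖⁻¹ • u with hûdef
  have hw1 : ∀ t, ‖w t‖ ≤ 1 := norm_direction_le_one hw
  have hcabs : ∀ t, |c t| ≤ ‖clip lam g t‖ := fun t =>
    (abs_real_inner_le_norm _ _).trans (mul_le_of_le_one_right (norm_nonneg _) (hw1 t))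
  have hû : ‖û‖ ≤ 1 := by
    rw [hûdef, norm_smul, norm_inv, norm_norm]
    exact inv_mul_le_one
  have huû : u = ‖u‖ • û := by
    rcases eq_or_ne u 0 with rfl | hu
    · simp
    · rw [hûdef, smul_inv_smul₀ (norm_ne_zero_iff.2 hu)]
  obtain ⟨-, hv, hs, h0, hvle, hmag⟩ := magnitude_regret (c := c) hε (norm_nonneg u)
    (rfl : hint lam g 1 = 0) T hlam (fun t _ => le_max_left _ _)
    (fun t ht => (hcabs _).trans (clip_succ_bounds g (hlam t ht)).1)
  have hclipsum : ∀ a : ℕ → ℝ, (∀ t ∈ Finset.Icc 1 T, a t ≤ ‖g t‖ ^ 2) →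
      ∑ t ∈ Finset.Icc 1 T, weight (fun j => lam j ^ 2) t T * a t ≤ gradVar lam g T := fun a ha =>
    Finset.sum_le_sum fun t ht => mul_le_mul_of_nonneg_left (ha t ht)
      (Finset.prod_nonneg fun _ _ => sq_nonneg _)
  have hclip : ∀ t ∈ Finset.Icc 1 T, ‖clip lam g t‖ ≤ ‖g t‖ := fun t ht => by
    obtain ⟨h1, h2⟩ := Finset.mem_Icc.1 ht
    obtain ⟨t, rfl⟩ := Nat.exists_eq_add_of_le' h1
    exact (clip_succ_bounds g (hlam t (by omega))).2.1
  have hQ : gradVar lam (clip lam g) T ≤ gradVar lam g T :=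
    hclipsum _ fun t ht => pow_le_pow_left₀ (norm_nonneg _) (hclip t ht) 2
  have hV : ∑ t ∈ Finset.Icc 1 T, weight (fun j => lam j ^ 2) t T * c t ^ 2 ≤ gradVar lam g T :=
    hclipsum _ fun t ht => by
      rw [← sq_abs]
      exact pow_le_pow_left₀ (abs_nonneg _) ((hcabs t).trans (hclip t ht)) 2
  refine ⟨_, _, hv, hs, fun h => (h0 h).2, hvle.trans hV, ?_⟩
  have hdir : ∑ t ∈ Finset.Icc 1 T, weight lam t T * inner ℝ (clip lam g t) (w t - û) ≤
      3 * √(gradVar lam g T) := by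
    refine (direction_regret hw hû T hlam).trans ?_
    have h1 := Real.sqrt_nonneg (gradVar lam (clip lam g) T)
    have h2 := Real.sqrt_le_sqrt hQ
    nlinarith [mul_nonneg h1 (sq_nonneg ‖direction lam (clip lam g) w₁ (T + 1) - û‖)]
  have hM0 : 0 ≤ M := (norm_nonneg (x 1)).trans
    (le_maxUpTo (fun t => ‖x t‖) (Finset.mem_Icc.2 ⟨le_rfl, hT⟩))
  have herr := sum_clip_error_le g T hlam
  have hround : ∀ t ∈ Finset.Icc 1 T, l t (x t) - l t u ≤
      (M + ‖u‖) * ‖g t - clip lam g t‖ + c t * (magIterate ε lam g w₁ t - ‖u‖)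
        + ‖u‖ * inner ℝ (clip lam g t) (w t - û) := fun t ht => by
    have hsub := hplay.subgrad t ht u
    have hx : x t = magIterate ε lam g w₁ t • w t := rfl
    have hsplit : inner ℝ (g t) (u - x t) = -(inner ℝ (g t - clip lam g t) (x t - u)
        + c t * (magIterate ε lam g w₁ t - ‖u‖)
        + ‖u‖ * inner ℝ (clip lam g t) (w t - û)) := by
      have e : inner ℝ (clip lam g t) u = ‖u‖ * inner ℝ (clip lam g t) û := by
        conv_lhs => rw [huû]
        rw [real_inner_smul_right]
      simp only [hcdef, inner_sub_left, inner_sub_right, e]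
      rw [hx, real_inner_smul_right, real_inner_smul_right]
      ring
    have hcs : inner ℝ (g t - clip lam g t) (x t - u) ≤ (M + ‖u‖) * ‖g t - clip lam g t‖ := by
      refine (real_inner_le_norm _ _).trans ?_
      rw [mul_comm]
      refine mul_le_mul_of_nonneg_right ((norm_sub_le _ _).trans ?_) (norm_nonneg _)
      linarith [le_maxUpTo (fun t => ‖x t‖) ht]
    rw [hsplit] at hsub
    linarith
  have hreg : regret lam l x T u ≤
      (M + ‖u‖) * ∑ t ∈ Finset.Icc 1 T, weight lam t T * ‖g t - clip lam g t‖
        + ∑ t ∈ Finset.Icc 1 T, weight lam t T * (c t * (magIterate ε lam g w₁ t - ‖u‖))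
        + ‖u‖ * ∑ t ∈ Finset.Icc 1 T, weight lam t T * inner ℝ (clip lam g t) (w t - û) := by
    rw [Finset.mul_sum, Finset.mul_sum, ← Finset.sum_add_distrib, ← Finset.sum_add_distrib]
    refine Finset.sum_le_sum fun t ht => ?_
    have := mul_le_mul_of_nonneg_left (hround t ht) (weight_nonneg hlam t)
    linarith
  have h1 := mul_le_mul_of_nonneg_left herr (add_nonneg hM0 (norm_nonneg u))
  have h2 := mul_le_mul_of_nonneg_left hdir (norm_nonneg u)
  have h3 := mul_le_mul_of_nonneg_left (hint_le_gradMax lam g hT) hM0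
  have hmag' : ∑ t ∈ Finset.Icc 1 T, weight lam t T * (c t * (magIterate ε lam g w₁ t - ‖u‖)) ≤ _ :=
    hmag
  linarith

end DiscountedOCO

open DiscountedOCO in
theorem theorem3 :
    (∀ ρ : ℝ, 1 < ρ → ∃ C : ℝ, 0 < C ∧
      ∀ (d : ℕ) (ε : ℝ) (w₁ : Vec d), 0 < ε → ‖w₁‖ ≤ 1 →
      ∀ (T : ℕ) (lam : ℕ → ℝ) (l : ℕ → Vec d → ℝ) (g : ℕ → Vec d), 1 ≤ T →
      IsPlay ε w₁ T lam l g →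
      ∀ u : Vec d, ρ * ε ≤ ‖u‖ →
        regret lam l (iterate ε lam g w₁) T u ≤
          C * max (‖u‖ * √(gradVar lam g T * Real.log (‖u‖ / ε)))
              (‖u‖ * gradMax lam g T * Real.log (‖u‖ / ε))
            + maxUpTo (fun t => ‖iterate ε lam g w₁ t‖) T * gradMax lam g T) ∧
    (∃ C : ℝ, 0 < C ∧
      ∀ (d : ℕ) (ε : ℝ) (w₁ : Vec d), 0 < ε → ‖w₁‖ ≤ 1 →
      ∀ (T : ℕ) (lam : ℕ → ℝ) (l : ℕ → Vec d → ℝ) (g : ℕ → Vec d), 1 ≤ T →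
      IsPlay ε w₁ T lam l g →
        regret lam l (iterate ε lam g w₁) T 0 ≤
          C * (ε * √(gradVar lam g T))
            + maxUpTo (fun t => ‖iterate ε lam g w₁ t‖) T * gradMax lam g T) := by
  refine ⟨fun ρ hρ => ?_, 9, by norm_num, ?_⟩
  · have hlogρ : 0 < Real.log ρ := Real.log_pos hρ
    -- `κ ≥ 1 / √(log (‖u‖ / ε))` absorbs the terms without a logarithm.
    obtain ⟨κ, hκdef⟩ : ∃ κ, κ = 1 / √(Real.log ρ) := ⟨_, rfl⟩
    have hκ : 0 < κ := by rw [hκdef]; positivity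
    obtain ⟨c₁, hc₁⟩ : ∃ c, c = 2 * (5 * κ + 2) + κ := ⟨_, rfl⟩
    obtain ⟨c₂, hc₂⟩ : ∃ c, c = 4 * (5 * κ + 2 + κ) := ⟨_, rfl⟩
    have hc₁p : 0 < c₁ := by rw [hc₁]; positivity
    have hc₂p : 0 < c₂ := by rw [hc₂]; positivity
    refine ⟨(c₁ + 3 * κ) + (c₁ * c₂ + κ ^ 2), by positivity, ?_⟩
    intro d ε w₁ hε hw T lam l g hT hplay u hu
    obtain ⟨v, s, hv, hs, h0, hvV, hreg⟩ := regret_le hε hw hT hplay u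
    have hhG := hint_le_gradMax lam g hT
    have hh := hint_nonneg lam g (T + 1)
    have hupos : 0 < ‖u‖ := lt_of_lt_of_le (by positivity) hu
    have hρu : ρ ≤ ‖u‖ / ε := (le_div_iff₀ hε).2 hu
    have hL : Real.log ρ ≤ Real.log (‖u‖ / ε) := Real.log_le_log (by linarith) hρu
    have hLpos : 0 < Real.log (‖u‖ / ε) := by linarith
    have hbsq : √(Real.log (‖u‖ / ε)) ^ 2 = Real.log (‖u‖ / ε) := Real.sq_sqrt hLpos.le
    have hb : 0 < √(Real.log (‖u‖ / ε)) := Real.sqrt_pos.2 hLpos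
    have hκb : 1 ≤ κ * √(Real.log (‖u‖ / ε)) := by
      rw [hκdef, div_mul_eq_mul_div, one_mul, one_le_div (Real.sqrt_pos.2 hlogρ)]
      exact Real.sqrt_le_sqrt hL
    have hexp : ε * Real.exp (√(Real.log (‖u‖ / ε)) ^ 2) = ‖u‖ := by
      rw [hbsq, Real.exp_log (by positivity)]
      field_simp
    have hconj := mul_sub_potential_le hε hb.le hκ.le hκb hh hv hs h0 hvV
    rw [hexp, ← hc₁, ← hc₂] at hconj
    rw [Real.sqrt_mul (gradVar_nonneg lam g T), ← hbsq, Real.sqrt_sq hb.le]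
    have hV := Real.sqrt_nonneg (gradVar lam g T)
    generalize √(Real.log (‖u‖ / ε)) = b at *
    generalize √(gradVar lam g T) = r at *
    generalize hint lam g (T + 1) = h at *
    generalize gradMax lam g T = G at *
    have h1 : r ≤ κ * (r * b) := by nlinarith
    have h2 : h ≤ κ ^ 2 * (G * b ^ 2) := by
      have h3 : 1 ≤ (κ * b) ^ 2 := one_le_pow₀ hκb
      nlinarith [hh.trans hhG]
    have h3 : c₁ * b * (c₂ * (h * b) + r) ≤ c₁ * (r * b) + c₁ * c₂ * (G * b ^ 2) := by
      have : c₁ * c₂ * b ^ 2 * h ≤ c₁ * c₂ * b ^ 2 * G := by gcongr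
      linarith
    have h4 : ‖u‖ * (c₁ * b * (c₂ * (h * b) + r)) + ‖u‖ * (3 * r + h) ≤
        (c₁ + 3 * κ) * (‖u‖ * (r * b)) + (c₁ * c₂ + κ ^ 2) * (‖u‖ * G * b ^ 2) := by
      have : c₁ * b * (c₂ * (h * b) + r) + (3 * r + h) ≤
        (c₁ + 3 * κ) * (r * b) + (c₁ * c₂ + κ ^ 2) * (G * b ^ 2) := by linarith
      have := mul_le_mul_of_nonneg_left this hupos.le
      linarith
    have h5 := mul_le_mul_of_nonneg_left (le_max_left (‖u‖ * (r * b)) (‖u‖ * G * b ^ 2))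
      (by positivity : 0 ≤ c₁ + 3 * κ)
    have h6 := mul_le_mul_of_nonneg_left (le_max_right (‖u‖ * (r * b)) (‖u‖ * G * b ^ 2))
      (by positivity : 0 ≤ c₁ * c₂ + κ ^ 2)
    linarith
  · intro d ε w₁ hε hw T lam l g hT hplay
    obtain ⟨v, s, hv, hs, h0, hvV, hreg⟩ := regret_le hε hw hT hplay 0
    have hpot := mul_le_mul_of_nonneg_left (neg_potential_le (hint_nonneg lam g (T + 1)) hv hs h0
      hvV (hint_sq_le_gradVar lam g T)) hε.le
    simp only [norm_zero, zero_mul, mul_zero, zero_sub, add_zero] at hreg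
    linarith
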